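/- For real numbers $p,q,r,s$ and $a,b>0$, define the more extended (four-parameter) mean $F(p,q;r,s;a,b)$ as follows. Let $L(x,y)=\frac{x-y}{\ln x-\ln y}$ for $x\ne y$ and $L(x,x)=x$ be the logarithmic mean of positive numbers. Put $F(p,q;r,s;a,a)=a$, and for $a\neq b$ put $$F(p,q;r,s;a,b)=\left(\frac{L(a^{pr},b^{pr})}{L(a^{ps},b^{ps})}\cdot\frac{L(a^{qs},b^{qs})}{L(a^{qr},b^{qr})}\right)^{\frac{1}{(p-q)(r-s)}}\quad\text{if } pqrs(p-q)(r-s)\neq 0,$$ while if $pqrs(p-q)(r-s)=0$, $F(p,q;r,s;a,b)$ is the limit of these values as parameters $(p',q',r',s')$ with $p'q'r's'(p'-q')(r'-s')\neq 0$ tend to $(p,q,r,s)$ (this limit always exists). **Theorem 3.1.** Fix $(r,s)\in\mathbb{R}^2$ and $a,b>0$ with $a\neq b$. If $r+s>0$, then the function $(p,q)\mapsto F(p,q;r,s;a,b)$ is strictly log-concave on $[0,\infty)\times[0,\infty)$ and strictly log-convex on $(-\infty,0]\times(-\infty,0]$. If $r+s<0$, then it is strictly log-convex on $[0,\infty)\times[0,\infty)$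 and strictly log-concave on $(-\infty,0]\times(-\infty,0]$. Here a positive function is called strictly log-concave (log-convex) on a convex set if its logarithm is strictly concave (convex) there, jointly in $(p,q)$. -/

import Mathlib

open Filter Topology

noncomputable section

namespace MoreExtendedMean

/-- The logarithmic mean `L(x, y)` of positive numbers, with `L(x, x) = x`. -/
def logMean (x y : ℝ) : ℝ :=
  if x = y then x else (x - y) / (Real.log x - Real.log y)

/-- The nondegenerate parameter quadruples `(p, q, r, s)`. -/
def nondegenerate : Set (ℝ × ℝ × ℝ × ℝ) :=
  {z | z.1 * z.2.1 * z.2.2.1 * z.2.2.2 * (z.1 - z.2.1) * (z.2.2.1 - z.2.2.2) ≠ 0}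

/-- The quotient formula for `F(p, q; r, s; a, b)`, used at nondegenerate parameters. -/
def quotientFormula (a b : ℝ) (z : ℝ × ℝ × ℝ × ℝ) : ℝ :=
  (logMean (a ^ (z.1 * z.2.2.1)) (b ^ (z.1 * z.2.2.1)) /
      logMean (a ^ (z.1 * z.2.2.2)) (b ^ (z.1 * z.2.2.2)) *
    (logMean (a ^ (z.2.1 * z.2.2.2)) (b ^ (z.2.1 * z.2.2.2)) /
      logMean (a ^ (z.2.1 * z.2.2.1)) (b ^ (z.2.1 * z.2.2.1)))) ^
    (1 / ((z.1 - z.2.1) * (z.2.2.1 - z.2.2.2)))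

open Classical in
/-- The more extended (four-parameter) mean `F(p, q; r, s; a, b)`: the quotient formula at
nondegenerate parameters, and its limit through nondegenerate parameters elsewhere. The limit
always exists and is unique: see `dense_nondegenerate` and `tendsto_quotientFormula`. -/
def moreExtendedMean (p q r s a b : ℝ) : ℝ :=
  if a = b then a
  else if (p, q, r, s) ∈ nondegenerate then quotientFormula a b (p, q, r, s)
  else limUnder (𝓝[nondegenerate] (p, q, r, s)) (quotientFormula a b)

/-- `f` is positive and `log f` is strictly concave on `S`. -/
def StrictLogConcaveOn (S : Set (ℝ × ℝ)) (f : ℝ × ℝ → ℝ) : Prop :=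
  (∀ x ∈ S, 0 < f x) ∧ StrictConcaveOn ℝ S (fun x => Real.log (f x))

/-- `f` is positive and `log f` is strictly convex on `S`. -/
def StrictLogConvexOn (S : Set (ℝ × ℝ)) (f : ℝ × ℝ → ℝ) : Prop :=
  (∀ x ∈ S, 0 < f x) ∧ StrictConvexOn ℝ S (fun x => Real.log (f x))

/-! Existence and uniqueness of the limits in the definition of `moreExtendedMean`. -/

theorem dense_nondegenerate : Dense nondegenerate := by
  rintro ⟨p, q, r, s⟩
  have hc : Continuous fun t : ℝ => ((p + t, q + 2 * t, r + t, s + 2 * t) : ℝ × ℝ × ℝ × ℝ) := by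
    fun_prop
  have ht : Tendsto (fun t : ℝ => ((p + t, q + 2 * t, r + t, s + 2 * t) : ℝ × ℝ × ℝ × ℝ))
      (𝓝[≠] 0) (𝓝 (p, q, r, s)) := by
    simpa using (hc.tendsto 0).mono_left nhdsWithin_le_nhds
  have hne : ∀ c : ℝ, ∀ᶠ t in 𝓝[≠] (0 : ℝ), t ≠ c := by
    intro c
    by_cases h0 : c = 0
    · subst h0
      exact self_mem_nhdsWithin
    · exact nhdsWithin_le_nhds (isOpen_ne.mem_nhds (Ne.symm h0))
  refine mem_closure_of_tendsto ht ?_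
  filter_upwards [hne (-p), hne (-q / 2), hne (-r), hne (-s / 2), hne (p - q), hne (r - s)]
    with t h1 h2 h3 h4 h5 h6
  simp only [nondegenerate, Set.mem_ofPred_eq]
  have e1 : p + t ≠ 0 := fun h => h1 (by linarith)
  have e2 : q + 2 * t ≠ 0 := fun h => h2 (by linarith)
  have e3 : r + t ≠ 0 := fun h => h3 (by linarith)
  have e4 : s + 2 * t ≠ 0 := fun h => h4 (by linarith)
  have e5 : p + t - (q + 2 * t) ≠ 0 := fun h => h5 (by linarith)
  have e6 : r + t - (s + 2 * t) ≠ 0 := fun h => h6 (by linarith)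
  exact mul_ne_zero (mul_ne_zero (mul_ne_zero (mul_ne_zero (mul_ne_zero e1 e2) e3) e4) e5) e6

theorem logMean_rpow_pos {a b : ℝ} (ha : 0 < a) (hb : 0 < b) (x : ℝ) :
    0 < logMean (a ^ x) (b ^ x) := by
  have hA : 0 < a ^ x := Real.rpow_pos_of_pos ha x
  have hB : 0 < b ^ x := Real.rpow_pos_of_pos hb x
  unfold logMean
  split_ifs with h
  · exact hA
  · rcases lt_or_gt_of_ne h with h | h
    · have := Real.log_lt_log hA h
      exact div_pos_of_neg_of_neg (by linarith) (by linarith)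
    · have := Real.log_lt_log hB h
      exact div_pos (by linarith) (by linarith)

theorem contDiff_log_logMean {a b : ℝ} (ha : 0 < a) (hb : 0 < b) (hab : a ≠ b) :
    ContDiff ℝ 2 (fun x : ℝ => Real.log (logMean (a ^ x) (b ^ x))) := by
  have hc : Real.log a - Real.log b ≠ 0 := by
    intro h
    exact hab (Real.log_injOn_pos ha hb (by linarith))
  set c := Real.log a - Real.log b with hcdef
  set E : ℝ → ℝ := fun x => (Real.exp (Real.log a * x) - Real.exp (Real.log b * x)) / c with hE
  have hEan : ∀ x, AnalyticAt ℝ E x := by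
    intro x
    have h1 : ∀ k : ℝ, AnalyticAt ℝ (fun x : ℝ => Real.exp (k * x)) x := fun k =>
      (analyticAt_const.mul analyticAt_id).rexp
    exact ((h1 _).sub (h1 _)).div_const
  have hE0 : E 0 = 0 := by simp [hE]
  have hEd : HasDerivAt E 1 0 := by
    have h1 : ∀ k : ℝ, HasDerivAt (fun x : ℝ => Real.exp (k * x)) k 0 := fun k => by
      simpa using ((hasDerivAt_id (0 : ℝ)).const_mul k).exp
    have h2 := ((h1 (Real.log a)).sub (h1 (Real.log b))).div_const c
    rw [← hcdef, div_self hc] at h2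
    exact h2
  have hM : (fun x : ℝ => logMean (a ^ x) (b ^ x)) = dslope E 0 := by
    funext x
    by_cases hx : x = 0
    · subst hx
      simp [logMean, dslope_same, hEd.deriv]
    · have hne : a ^ x ≠ b ^ x := by
        intro h
        exact hab ((Real.rpow_left_inj ha.le hb.le hx).1 h)
      rw [dslope_of_ne _ hx, slope_def_field, hE0, logMean, if_neg hne, Real.log_rpow ha,
        Real.log_rpow hb, ← mul_sub, ← hcdef, Real.rpow_def_of_pos ha, Real.rpow_def_of_pos hb,
        sub_zero, sub_zero, div_div, mul_comm x c]
  have hMan : ∀ x, AnalyticAt ℝ (dslope E 0) x := by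
    intro x
    by_cases hx : x = 0
    · subst hx
      obtain ⟨P, hP⟩ := hEan 0
      exact hP.has_fpower_series_dslope_fslope.analyticAt
    · have : AnalyticAt ℝ (fun y => (y - 0)⁻¹ * (E y - E 0)) x :=
        ((analyticAt_id.sub analyticAt_const).inv (by simpa using hx)).mul
          ((hEan x).sub analyticAt_const)
      refine this.congr ?_
      filter_upwards [isOpen_ne.mem_nhds hx] with y hy
      rw [dslope_of_ne _ hy, slope_def_field]
      ring
  rw [contDiff_iff_contDiffAt]
  intro x
  have h1 : ContDiffAt ℝ 2 (fun x : ℝ => logMean (a ^ x) (b ^ x)) x := by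
    rw [hM]
    exact (hMan x).contDiffAt
  exact h1.log (logMean_rpow_pos ha hb x).ne'

theorem sub_eq_mul_integral {ψ ψ' : ℝ → ℝ} (h : ∀ x, HasDerivAt ψ (ψ' x) x)
    (hc : Continuous ψ') (x y : ℝ) :
    ψ x - ψ y = (x - y) * ∫ v in (0 : ℝ)..1, ψ' (y + v * (x - y)) := by
  have hd : ∀ v ∈ Set.uIcc (0 : ℝ) 1,
      HasDerivAt (fun v => ψ (y + v * (x - y))) (ψ' (y + v * (x - y)) * (x - y)) v := by
    intro v _
    have h1 : HasDerivAt (fun v : ℝ => y + v * (x - y)) (x - y) v := by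
      simpa using ((hasDerivAt_id v).mul_const (x - y)).const_add y
    exact (h (y + v * (x - y))).comp v h1
  have := intervalIntegral.integral_eq_sub_of_hasDerivAt hd
    (Continuous.intervalIntegrable (by fun_prop) _ _)
  rw [intervalIntegral.integral_mul_const] at this
  rw [mul_comm, this]
  simp

theorem exists_continuous_divided_difference {φ : ℝ → ℝ} (h : ContDiff ℝ 2 φ) :
    ∃ Ψ : ℝ × ℝ × ℝ × ℝ → ℝ, Continuous Ψ ∧ ∀ p q r s : ℝ,
      φ (p * r) - φ (p * s) + φ (q * s) - φ (q * r) = (p - q) * (r - s) * Ψ (p, q, r, s) := by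
  have h1 : ContDiff ℝ 1 (deriv φ) := by
    have : ContDiff ℝ (1 + 1) φ := by simpa [one_add_one_eq_two] using h
    exact (contDiff_succ_iff_deriv.1 this).2.2
  have d0 : ∀ x, HasDerivAt φ (deriv φ x) x := fun x =>
    (h.differentiable (by norm_num) x).hasDerivAt
  have d1 : ∀ x, HasDerivAt (deriv φ) (deriv (deriv φ) x) x := fun x =>
    (h1.differentiable (by norm_num) x).hasDerivAt
  have c1 : Continuous (deriv φ) := h1.continuous
  have c2 : Continuous (deriv (deriv φ)) := h1.continuous_deriv le_rfl
  set θ : ℝ → ℝ := fun x => deriv φ x + x * deriv (deriv φ) x with hθ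
  have cθ : Continuous θ := by fun_prop
  refine ⟨fun z => ∫ v in (0 : ℝ)..1, ∫ u in (0 : ℝ)..1,
    θ ((z.2.1 + u * (z.1 - z.2.1)) * (z.2.2.2 + v * (z.2.2.1 - z.2.2.2))), ?_, ?_⟩
  · refine intervalIntegral.continuous_parametric_intervalIntegral_of_continuous' ?_ 0 1
    refine intervalIntegral.continuous_parametric_intervalIntegral_of_continuous'
      (f := fun (w : (ℝ × ℝ × ℝ × ℝ) × ℝ) u => θ ((w.1.2.1 + u * (w.1.1 - w.1.2.1)) *
        (w.1.2.2.2 + w.2 * (w.1.2.2.1 - w.1.2.2.2)))) ?_ 0 1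
    fun_prop
  · intro p q r s
    have hm : ∀ k w : ℝ, HasDerivAt (fun w => φ (k * w)) (k * deriv φ (k * w)) w := by
      intro k w
      have h2 : HasDerivAt (fun w : ℝ => k * w) k w := by
        simpa using (hasDerivAt_id w).const_mul k
      exact ((d0 (k * w)).comp w h2).congr_deriv (mul_comm _ _)
    have e1 := sub_eq_mul_integral (ψ := fun w => φ (p * w) - φ (q * w))
      (fun w => (hm p w).sub (hm q w)) (by fun_prop) r s
    have e2 : ∀ w, p * deriv φ (p * w) - q * deriv φ (q * w) =
        (p - q) * ∫ u in (0 : ℝ)..1, θ ((q + u * (p - q)) * w) := by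
      intro w
      refine sub_eq_mul_integral (ψ := fun m => m * deriv φ (m * w))
        (ψ' := fun m => θ (m * w)) (fun m => ?_) (by fun_prop) p q
      have h2 : HasDerivAt (fun m : ℝ => m * w) w m := by
        simpa using (hasDerivAt_id m).mul_const w
      have h3 := (hasDerivAt_id m).mul ((d1 (m * w)).comp m h2)
      refine h3.congr_deriv ?_
      simp [hθ]
      ring
    simp only [e2, intervalIntegral.integral_const_mul] at e1
    linear_combination e1

theorem exists_continuous_log_quotientFormula {a b : ℝ} (ha : 0 < a) (hb : 0 < b) (hab : a ≠ b) :
    ∃ Ψ : ℝ × ℝ × ℝ × ℝ → ℝ, Continuous Ψ ∧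
      ∀ z ∈ nondegenerate, quotientFormula a b z = Real.exp (Ψ z) := by
  obtain ⟨Ψ, hΨ, he⟩ := exists_continuous_divided_difference (contDiff_log_logMean ha hb hab)
  refine ⟨Ψ, hΨ, ?_⟩
  rintro ⟨p, q, r, s⟩ hz
  have hL := logMean_rpow_pos ha hb
  have hz' : (p - q) * (r - s) ≠ 0 := by
    simp only [nondegenerate, Set.mem_ofPred_eq] at hz
    intro h
    apply hz
    linear_combination p * q * r * s * h
  have e := he p q r s
  simp only [quotientFormula]
  rw [Real.rpow_def_of_pos
      (mul_pos (div_pos (hL _) (hL _)) (div_pos (hL _) (hL _))),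
    Real.log_mul (div_pos (hL _) (hL _)).ne' (div_pos (hL _) (hL _)).ne',
    Real.log_div (hL _).ne' (hL _).ne', Real.log_div (hL _).ne' (hL _).ne']
  congr 1
  rw [mul_one_div, div_eq_iff hz']
  linear_combination e

theorem tendsto_quotientFormula {a b : ℝ} (ha : 0 < a) (hb : 0 < b) (hab : a ≠ b)
    (p q r s : ℝ) :
    Tendsto (quotientFormula a b) (𝓝[nondegenerate] (p, q, r, s))
      (𝓝 (moreExtendedMean p q r s a b)) := by
  obtain ⟨Ψ, hΨ, he⟩ := exists_continuous_log_quotientFormula ha hb hab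
  have ht : Tendsto (quotientFormula a b) (𝓝[nondegenerate] (p, q, r, s))
      (𝓝 (Real.exp (Ψ (p, q, r, s)))) := by
    have h1 : Tendsto (fun z => Real.exp (Ψ z)) (𝓝[nondegenerate] (p, q, r, s))
        (𝓝 (Real.exp (Ψ (p, q, r, s)))) :=
      ((Real.continuous_exp.comp hΨ).tendsto _).mono_left nhdsWithin_le_nhds
    refine h1.congr' ?_
    filter_upwards [self_mem_nhdsWithin] with z hz using (he z hz).symm
  unfold moreExtendedMean
  rw [if_neg hab]
  split_ifs with hz
  · rw [he _ hz]
    exact ht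
  · exact tendsto_nhds_limUnder ⟨_, ht⟩

end MoreExtendedMean

end

open MeasureTheory Set

namespace MoreExtendedMean

/-! ### The hyperbolic inequality -/

/-! Put φ(x) = log L(a^x, b^x). The exponent of F is a second-order divided difference of (t, w) ↦
φ(tw), so log F is the average over t between q and p of g(t), where g(t) is the average of θ(tw)
over w between s and r and θ(x) = (xφ'(x))'. Explicitly θ(x) = m + hκ(hx), with m = (ln a + ln b)/2,
h = (ln a - ln b)/2 and κ(u) = (u coth u)'. So θ is antisymmetric about (0, m), and it is strictly
concave on [0, ∞) because κ'' < 0 there (`exists_kernel`).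

For fixed convex weights and points x, y ≥ 0, the Jensen defect of t ↦ θ(tw) is odd in w and
positive for w > 0. Its average over w is therefore positive when r + s > 0, so g is strictly
concave on [0, ∞) (`strictConcaveOn_segmentMean_dilation`). Averaging over the segment from q to p
makes this joint strict concavity in (p, q) (`strictConcaveOn_segmentMean`). The other three cases
follow from g(-t) = 2m - g(t) and from (r, s) ↦ (-r, -s). -/

theorem sinh_lt_mul_cosh {u : ℝ} (hu : 0 < u) : Real.sinh u < u * Real.cosh u := by
  have hd : ∀ x, HasDerivAt (fun u : ℝ => u * Real.cosh u - Real.sinh u) (x * Real.sinh x) x := by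
    intro x
    refine (((hasDerivAt_id x).mul (Real.hasDerivAt_cosh x)).sub
      (Real.hasDerivAt_sinh x)).congr_deriv ?_
    simp
  have hm : StrictMonoOn (fun u : ℝ => u * Real.cosh u - Real.sinh u) (Ici 0) := by
    refine strictMonoOn_of_deriv_pos (convex_Ici 0)
      (fun x _ => (hd x).continuousAt.continuousWithinAt) fun x hx => ?_
    rw [interior_Ici] at hx
    rw [(hd x).deriv]
    exact mul_pos hx (Real.sinh_pos_iff.2 hx)
  have := hm (mem_Ici.2 le_rfl) (mem_Ici.2 hu.le) hu
  simp only [zero_mul, Real.sinh_zero, sub_zero] at this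
  linarith

/-- This is the sign of κ'': κ''(u) is twice the left side over sinh⁴ u. The left side vanishes at 0
and has derivative 4 sinh u (sinh u - u cosh u) < 0. -/
theorem mul_sinh_sq_sub_mul_cosh_sq_add_neg {u : ℝ} (hu : 0 < u) :
    u * Real.sinh u ^ 2 - 3 * u * Real.cosh u ^ 2 + 3 * Real.sinh u * Real.cosh u < 0 := by
  set n : ℝ → ℝ := fun u =>
    u * Real.sinh u ^ 2 - 3 * u * Real.cosh u ^ 2 + 3 * Real.sinh u * Real.cosh u with hn
  have hd : ∀ x, HasDerivAt n (4 * Real.sinh x * (Real.sinh x - x * Real.cosh x)) x := by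
    intro x
    have hs := Real.hasDerivAt_sinh x
    have hc := Real.hasDerivAt_cosh x
    have hi := hasDerivAt_id x
    refine (((hi.mul (hs.pow 2)).sub ((hi.const_mul 3).mul (hc.pow 2))).add
      ((hs.const_mul 3).mul hc)).congr_deriv ?_
    simp
    ring
  have hm : StrictAntiOn n (Ici 0) := by
    refine strictAntiOn_of_deriv_neg (convex_Ici 0)
      (fun x _ => (hd x).continuousAt.continuousWithinAt) fun x hx => ?_
    rw [interior_Ici] at hx
    rw [(hd x).deriv]
    have h1 := sinh_lt_mul_cosh hx
    have h2 := Real.sinh_pos_iff.2 hx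
    exact mul_neg_of_pos_of_neg (by linarith) (by linarith)
  have := hm (mem_Ici.2 le_rfl) (mem_Ici.2 hu.le) hu
  simpa [hn] using this

/-- The derivative of `u * coth u`. -/
noncomputable def kappa (u : ℝ) : ℝ := Real.cosh u / Real.sinh u - u / Real.sinh u ^ 2

theorem kappa_neg (u : ℝ) : kappa (-u) = -kappa u := by
  simp [kappa]
  ring

theorem hasDerivAt_kappa {u : ℝ} (hu : u ≠ 0) :
    HasDerivAt kappa (2 * (u * Real.cosh u - Real.sinh u) / Real.sinh u ^ 3) u := by
  have h0 : Real.sinh u ≠ 0 := Real.sinh_ne_zero.2 hu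
  have hs := Real.hasDerivAt_sinh u
  refine (((Real.hasDerivAt_cosh u).div hs h0).sub
    ((hasDerivAt_id u).div (hs.pow 2) (pow_ne_zero 2 h0))).congr_deriv ?_
  have h1 := Real.cosh_sq u
  simp
  field_simp
  linear_combination (-Real.sinh u) * h1

theorem strictAntiOn_deriv_kappa :
    StrictAntiOn (fun u => 2 * (u * Real.cosh u - Real.sinh u) / Real.sinh u ^ 3) (Ioi 0) := by
  have hd : ∀ u, 0 < u → HasDerivAt
      (fun u => 2 * (u * Real.cosh u - Real.sinh u) / Real.sinh u ^ 3)
      (2 * (u * Real.sinh u ^ 2 - 3 * u * Real.cosh u ^ 2 + 3 * Real.sinh u * Real.cosh u) /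
        Real.sinh u ^ 4) u := by
    intro u hu
    have h0 : Real.sinh u ≠ 0 := Real.sinh_ne_zero.2 hu.ne'
    have hs := Real.hasDerivAt_sinh u
    refine (((((hasDerivAt_id u).mul (Real.hasDerivAt_cosh u)).sub hs).const_mul 2).div
      (hs.pow 3) (pow_ne_zero 3 h0)).congr_deriv ?_
    simp
    field_simp
    ring
  refine strictAntiOn_of_deriv_neg (convex_Ioi 0)
    (fun x hx => (hd x hx).continuousAt.continuousWithinAt) fun x hx => ?_
  rw [interior_Ioi] at hx
  rw [(hd x hx).deriv]
  have h1 := mul_sinh_sq_sub_mul_cosh_sq_add_neg hx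
  have h2 := Real.sinh_pos_iff.2 hx
  exact div_neg_of_neg_of_pos (by linarith) (by positivity)

theorem strictConcaveOn_of_eq_kappa {θ : ℝ → ℝ} (hθ : Continuous θ) {m h : ℝ} (hh : h ≠ 0)
    (he : ∀ x, x ≠ 0 → θ x = m + h * kappa (h * x)) : StrictConcaveOn ℝ (Ici 0) θ := by
  -- Since κ is odd, h κ(hx) is even in h.
  wlog hpos : 0 < h generalizing h
  · refine this (neg_ne_zero.2 hh) (fun x hx => ?_) ?_
    · rw [he x hx, neg_mul, neg_mul, kappa_neg]
      ring
    · exact neg_pos.2 (lt_of_le_of_ne (not_lt.1 hpos) hh)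
  have hd : ∀ x ∈ Ioi (0 : ℝ), deriv θ x =
      h * (h * (2 * (h * x * Real.cosh (h * x) - Real.sinh (h * x)) / Real.sinh (h * x) ^ 3)) := by
    intro x hx
    have h1 : θ =ᶠ[𝓝 x] fun x => m + h * kappa (h * x) := by
      filter_upwards [isOpen_ne.mem_nhds (ne_of_gt hx)] with y hy using he y hy
    rw [h1.deriv_eq]
    have h2 : HasDerivAt (fun x : ℝ => h * x) h x := by
      simpa using (hasDerivAt_id x).const_mul h
    have h3 := (hasDerivAt_kappa (mul_ne_zero hh (ne_of_gt hx))).comp x h2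
    refine ((h3.const_mul h).const_add m).deriv.trans ?_
    ring
  refine StrictAntiOn.strictConcaveOn_of_deriv (convex_Ici 0) hθ.continuousOn ?_
  rw [interior_Ici]
  intro x hx y hy hxy
  rw [hd x hx, hd y hy]
  have := strictAntiOn_deriv_kappa (mem_Ioi.2 (mul_pos hpos hx)) (mem_Ioi.2 (mul_pos hpos hy))
    (mul_lt_mul_of_pos_left hxy hpos)
  exact mul_lt_mul_of_pos_left (mul_lt_mul_of_pos_left this hpos) hpos

/-! ### Averages over segments -/

/-- The mean of `f` over the segment from `s` to `r`. -/
noncomputable def segmentMean (f : ℝ → ℝ) (r s : ℝ) : ℝ := ∫ v in (0 : ℝ)..1, f (s + v * (r - s))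

theorem sub_mul_segmentMean (f : ℝ → ℝ) (r s : ℝ) :
    (r - s) * segmentMean f r s = ∫ w in s..r, f w := by
  have := intervalIntegral.smul_integral_comp_add_mul (a := 0) (b := 1) f (r - s) s
  simp only [smul_eq_mul, mul_zero, add_zero, mul_one, add_sub_cancel] at this
  rw [← this, segmentMean]
  simp only [mul_comm]

theorem segmentMean_swap (f : ℝ → ℝ) (r s : ℝ) : segmentMean f r s = segmentMean f s r := by
  by_cases h : r = s
  · rw [h]
  · have h1 := sub_mul_segmentMean f r s
    have h2 := sub_mul_segmentMean f s r
    rw [intervalIntegral.integral_symm] at h1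
    refine mul_left_cancel₀ (sub_ne_zero.2 h) ?_
    linarith

/-- Oddness cancels the integral from s to -s, which leaves the integral from |s| to r, where D > 0.
-/
theorem segmentMean_pos_of_odd {D : ℝ → ℝ} (hD : Continuous D) (hodd : ∀ x, D (-x) = -D x)
    (hpos : ∀ x, 0 < x → 0 < D x) {r s : ℝ} (hrs : 0 < r + s) : 0 < segmentMean D r s := by
  wlog hle : s ≤ r generalizing r s
  · rw [segmentMean_swap]
    exact this (by linarith) (by linarith)
  rcases hle.eq_or_lt with rfl | hlt
  · simpa [segmentMean] using hpos s (by linarith)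
  have hi : ∀ x y : ℝ, IntervalIntegrable D volume x y := fun x y => hD.intervalIntegrable x y
  have hz : ∫ w in s..-s, D w = 0 := by
    have h1 := intervalIntegral.integral_comp_neg (a := s) (b := -s) D
    simp only [hodd, intervalIntegral.integral_neg, neg_neg] at h1
    linarith
  have key : ∫ w in s..r, D w = ∫ w in |s|..r, D w := by
    rcases abs_cases s with ⟨h, -⟩ | ⟨h, -⟩
    · rw [h]
    · rw [h, ← intervalIntegral.integral_add_adjacent_intervals (hi s (-s)) (hi (-s) r), hz,
        zero_add]
  have h2 : 0 < ∫ w in |s|..r, D w :=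
    intervalIntegral.intervalIntegral_pos_of_pos_on (hi _ _)
      (fun x hx => hpos x ((abs_nonneg s).trans_lt hx.1)) (abs_lt.2 ⟨by linarith, hlt⟩)
  rw [← key, ← sub_mul_segmentMean] at h2
  exact pos_of_mul_pos_right h2 (by linarith)

/-- The sample point at each u is linear in the pair, so Jensen's inequality holds pointwise in u.
By continuity, strictness at a single u suffices. -/
theorem strictConcaveOn_segmentMean {f : ℝ → ℝ} (hf : Continuous f) {S : Set ℝ}
    (hc : StrictConcaveOn ℝ S f) :
    StrictConcaveOn ℝ (S ×ˢ S) (fun x : ℝ × ℝ => segmentMean f x.1 x.2) := by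
  have hmem : ∀ x ∈ S ×ˢ S, ∀ u ∈ Icc (0 : ℝ) 1, x.2 + u * (x.1 - x.2) ∈ S := by
    intro x hx u hu
    have := hc.1 hx.2 hx.1 (sub_nonneg.2 hu.2) hu.1 (by ring)
    simp only [smul_eq_mul] at this
    convert this using 1
    ring
  refine ⟨hc.1.prod hc.1, ?_⟩
  rintro x hx y hy hxy α β hα hβ hαβ
  have hint : ∀ z : ℝ × ℝ, IntervalIntegrable (fun u => f (z.2 + u * (z.1 - z.2))) volume 0 1 :=
    fun z => Continuous.intervalIntegrable (by fun_prop) _ _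
  have heq : ∀ u : ℝ, (α • x + β • y).2 + u * ((α • x + β • y).1 - (α • x + β • y).2) =
      α • (x.2 + u * (x.1 - x.2)) + β • (y.2 + u * (y.1 - y.2)) := by
    intro u
    simp
    ring
  simp only [smul_eq_mul, segmentMean]
  rw [← intervalIntegral.integral_const_mul, ← intervalIntegral.integral_const_mul,
    ← intervalIntegral.integral_add ((hint x).const_mul α) ((hint y).const_mul β)]
  refine intervalIntegral.integral_lt_integral_of_continuousOn_of_le_of_exists_lt one_pos
    (by fun_prop) (by fun_prop) (fun u hu => ?_) ?_
  · rw [heq]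
    exact hc.concaveOn.2 (hmem x hx u (Ioc_subset_Icc_self hu))
      (hmem y hy u (Ioc_subset_Icc_self hu)) hα.le hβ.le hαβ
  · have hlt : ∀ u ∈ Icc (0 : ℝ) 1, x.2 + u * (x.1 - x.2) ≠ y.2 + u * (y.1 - y.2) →
        α * f (x.2 + u * (x.1 - x.2)) + β * f (y.2 + u * (y.1 - y.2)) <
          f ((α • x + β • y).2 + u * ((α • x + β • y).1 - (α • x + β • y).2)) := by
      intro u hu hne
      rw [heq]
      exact hc.2 (hmem x hx u hu) (hmem y hy u hu) hne hα hβ hαβ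
    -- Distinct pairs differ in a coordinate; u = 1 samples the first and u = 0 the second.
    by_cases h2 : x.2 = y.2
    · have h1 : x.1 ≠ y.1 := fun h1 => hxy (Prod.ext h1 h2)
      exact ⟨1, by simp, hlt 1 (by simp) (by simpa using h1)⟩
    · exact ⟨0, by simp, hlt 0 (by simp) (by simpa using h2)⟩

theorem strictConvexOn_segmentMean {f : ℝ → ℝ} (hf : Continuous f) {S : Set ℝ}
    (hc : StrictConvexOn ℝ S f) :
    StrictConvexOn ℝ (S ×ˢ S) (fun x : ℝ × ℝ => segmentMean f x.1 x.2) := by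
  have he : (fun x : ℝ × ℝ => segmentMean f x.1 x.2) =
      -fun x : ℝ × ℝ => segmentMean (-f) x.1 x.2 := by
    funext x
    simp [segmentMean]
  rw [he]
  exact (strictConcaveOn_segmentMean hf.neg hc.neg).neg

/-! ### Averages of the dilates θ(t·) -/

section Dilation

variable {θ : ℝ → ℝ} {c : ℝ}

theorem continuous_segmentMean_dilation (hθ : Continuous θ) (r s : ℝ) :
    Continuous fun t => segmentMean (fun w => θ (t * w)) r s := by
  unfold segmentMean
  exact intervalIntegral.continuous_parametric_intervalIntegral_of_continuous' (by fun_prop) 0 1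

theorem segmentMean_dilation_neg_neg (r s t : ℝ) :
    segmentMean (fun w => θ (t * w)) (-r) (-s) = segmentMean (fun w => θ (-t * w)) r s := by
  unfold segmentMean
  congr 1
  funext v
  ring_nf

theorem segmentMean_dilation_neg (hθ : Continuous θ) (hodd : ∀ x, θ (-x) = c - θ x) (r s t : ℝ) :
    segmentMean (fun w => θ (-t * w)) r s = c - segmentMean (fun w => θ (t * w)) r s := by
  unfold segmentMean
  simp only [neg_mul, hodd]
  rw [intervalIntegral.integral_sub (by simp)
    (Continuous.intervalIntegrable (by fun_prop) _ _)]
  simp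

theorem strictConcaveOn_segmentMean_dilation (hθ : Continuous θ) (hodd : ∀ x, θ (-x) = c - θ x)
    (hc : StrictConcaveOn ℝ (Ici 0) θ) {r s : ℝ} (hrs : 0 < r + s) :
    StrictConcaveOn ℝ (Ici 0) fun t => segmentMean (fun w => θ (t * w)) r s := by
  refine ⟨convex_Ici 0, ?_⟩
  intro x hx y hy hxy α β hα hβ hαβ
  -- D is the Jensen defect as a function of w; in D(-w) the constant c cancels because α + β = 1.
  have hD := segmentMean_pos_of_odd
    (D := fun w => θ ((α • x + β • y) * w) - (α * θ (x * w) + β * θ (y * w)))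
    (by fun_prop) (fun w => ?_) (fun w hw => ?_) hrs
  · have hint : ∀ t : ℝ, IntervalIntegrable (fun v => θ (t * (s + v * (r - s)))) volume 0 1 :=
      fun t => Continuous.intervalIntegrable (by fun_prop) _ _
    unfold segmentMean at hD ⊢
    rw [intervalIntegral.integral_sub (hint _) (((hint x).const_mul α).add ((hint y).const_mul β)),
      intervalIntegral.integral_add ((hint x).const_mul α) ((hint y).const_mul β),
      intervalIntegral.integral_const_mul, intervalIntegral.integral_const_mul] at hD
    simp only [smul_eq_mul] at hD ⊢
    linarith
  · simp only [mul_neg, hodd]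
    linear_combination (-c) * hαβ
  · have := hc.2 (mem_Ici.2 (mul_nonneg hx hw.le)) (mem_Ici.2 (mul_nonneg hy hw.le))
      (fun h => hxy (mul_right_cancel₀ hw.ne' h)) hα hβ hαβ
    simp only [smul_eq_mul] at this ⊢
    rw [add_mul, mul_assoc, mul_assoc]
    linarith

end Dilation

theorem StrictConcaveOn.comp_neg_Iic {f : ℝ → ℝ} (hf : StrictConcaveOn ℝ (Ici 0) f) :
    StrictConcaveOn ℝ (Iic 0) fun t => f (-t) := by
  refine ⟨convex_Iic 0, ?_⟩
  intro x hx y hy hxy α β hα hβ hαβ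
  have := hf.2 (mem_Ici.2 (neg_nonneg.2 hx)) (mem_Ici.2 (neg_nonneg.2 hy))
    (fun h => hxy (neg_injective h)) hα hβ hαβ
  convert this using 2
  simp
  ring

theorem StrictConcaveOn.const_sub {f : ℝ → ℝ} {S : Set ℝ} (hf : StrictConcaveOn ℝ S f) (c : ℝ) :
    StrictConvexOn ℝ S fun t => c - f t := by
  have he : (fun t => c - f t) = fun t => (-f) t + c := by
    funext t
    simp only [Pi.neg_apply]
    ring
  rw [he]
  exact hf.neg.add_const c

/-! ### The integral formula for the mean -/

/-- The integrand is the mixed derivative ∂²/∂t∂w of φ(tw); the fundamental theorem of calculus is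
applied once in each variable. -/
theorem divided_difference_eq_segmentMean {φ : ℝ → ℝ} (h : ContDiff ℝ 2 φ) (p q r s : ℝ) :
    φ (p * r) - φ (p * s) + φ (q * s) - φ (q * r) = (p - q) * (r - s) *
      segmentMean (fun t => segmentMean
        (fun w => deriv φ (t * w) + t * w * deriv (deriv φ) (t * w)) r s) p q := by
  have h1 : ContDiff ℝ 1 (deriv φ) := by
    have : ContDiff ℝ (1 + 1) φ := by simpa [one_add_one_eq_two] using h
    exact (contDiff_succ_iff_deriv.1 this).2.2
  have d0 : ∀ x, HasDerivAt φ (deriv φ x) x := fun x =>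
    (h.differentiable (by norm_num) x).hasDerivAt
  have d1 : ∀ x, HasDerivAt (deriv φ) (deriv (deriv φ) x) x := fun x =>
    (h1.differentiable (by norm_num) x).hasDerivAt
  have c1 : Continuous (deriv φ) := h1.continuous
  have c2 : Continuous (deriv (deriv φ)) := h1.continuous_deriv le_rfl
  have hm : ∀ k t : ℝ, HasDerivAt (fun t => φ (t * k)) (k * deriv φ (t * k)) t := by
    intro k t
    have h2 : HasDerivAt (fun t : ℝ => t * k) k t := by
      simpa using (hasDerivAt_id t).mul_const k
    exact ((d0 (t * k)).comp t h2).congr_deriv (mul_comm _ _)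
  have e1 := sub_eq_mul_integral (ψ := fun t => φ (t * r) - φ (t * s))
    (fun t => (hm r t).sub (hm s t)) (by fun_prop) p q
  have e2 : ∀ t, r * deriv φ (t * r) - s * deriv φ (t * s) = (r - s) * segmentMean
      (fun w => deriv φ (t * w) + t * w * deriv (deriv φ) (t * w)) r s := by
    intro t
    refine sub_eq_mul_integral (ψ := fun w => w * deriv φ (t * w))
      (ψ' := fun w => deriv φ (t * w) + t * w * deriv (deriv φ) (t * w))
      (fun w => ?_) (by fun_prop) r s
    have h2 : HasDerivAt (fun w : ℝ => t * w) t w := by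
      simpa using (hasDerivAt_id w).const_mul t
    refine ((hasDerivAt_id w).mul ((d1 (t * w)).comp w h2)).congr_deriv ?_
    simp
    ring
  simp only [e2, intervalIntegral.integral_const_mul] at e1
  simp only [segmentMean] at e1 ⊢
  linear_combination e1

/-- The right side is continuous in all four parameters and agrees with the quotient formula at
nondegenerate ones. These are dense, so uniqueness of limits covers the degenerate cases. -/
theorem moreExtendedMean_eq_exp_segmentMean {a b : ℝ} (ha : 0 < a) (hb : 0 < b) (hab : a ≠ b)
    {φ : ℝ → ℝ} (hφ : φ = fun x => Real.log (logMean (a ^ x) (b ^ x))) (p q r s : ℝ) :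
    moreExtendedMean p q r s a b = Real.exp (segmentMean (fun t => segmentMean
        (fun w => deriv φ (t * w) + t * w * deriv (deriv φ) (t * w)) r s) p q) := by
  have h : ContDiff ℝ 2 φ := hφ ▸ contDiff_log_logMean ha hb hab
  have h1 : ContDiff ℝ 1 (deriv φ) := by
    have : ContDiff ℝ (1 + 1) φ := by simpa [one_add_one_eq_two] using h
    exact (contDiff_succ_iff_deriv.1 this).2.2
  have c1 : Continuous (deriv φ) := h1.continuous
  have c2 : Continuous (deriv (deriv φ)) := h1.continuous_deriv le_rfl
  set Ψ : ℝ × ℝ × ℝ × ℝ → ℝ := fun z => segmentMean (fun t => segmentMean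
    (fun w => deriv φ (t * w) + t * w * deriv (deriv φ) (t * w)) z.2.2.1 z.2.2.2) z.1 z.2.1 with hΨ
  have cΨ : Continuous Ψ := by
    simp only [hΨ, segmentMean]
    refine intervalIntegral.continuous_parametric_intervalIntegral_of_continuous' ?_ 0 1
    refine intervalIntegral.continuous_parametric_intervalIntegral_of_continuous'
      (f := fun (y : (ℝ × ℝ × ℝ × ℝ) × ℝ) v =>
        deriv φ ((y.1.2.1 + y.2 * (y.1.1 - y.1.2.1)) *
          (y.1.2.2.2 + v * (y.1.2.2.1 - y.1.2.2.2))) +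
        (y.1.2.1 + y.2 * (y.1.1 - y.1.2.1)) * (y.1.2.2.2 + v * (y.1.2.2.1 - y.1.2.2.2)) *
          deriv (deriv φ) ((y.1.2.1 + y.2 * (y.1.1 - y.1.2.1)) *
            (y.1.2.2.2 + v * (y.1.2.2.1 - y.1.2.2.2)))) ?_ 0 1
    fun_prop
  have hquot : ∀ z ∈ nondegenerate, quotientFormula a b z = Real.exp (Ψ z) := by
    rintro ⟨p, q, r, s⟩ hz
    have hL := logMean_rpow_pos ha hb
    have hz' : (p - q) * (r - s) ≠ 0 := by
      simp only [nondegenerate, Set.mem_ofPred_eq] at hz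
      intro h
      apply hz
      linear_combination p * q * r * s * h
    have e := divided_difference_eq_segmentMean h p q r s
    simp only [quotientFormula]
    rw [Real.rpow_def_of_pos
        (mul_pos (div_pos (hL _) (hL _)) (div_pos (hL _) (hL _))),
      Real.log_mul (div_pos (hL _) (hL _)).ne' (div_pos (hL _) (hL _)).ne',
      Real.log_div (hL _).ne' (hL _).ne', Real.log_div (hL _).ne' (hL _).ne']
    congr 1
    rw [mul_one_div, div_eq_iff hz']
    simp only [hφ] at e
    simp only [hΨ, hφ]
    linear_combination e
  have ht : Tendsto (quotientFormula a b) (𝓝[nondegenerate] (p, q, r, s))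
      (𝓝 (Real.exp (Ψ (p, q, r, s)))) := by
    refine (((Real.continuous_exp.comp cΨ).tendsto _).mono_left nhdsWithin_le_nhds).congr' ?_
    filter_upwards [self_mem_nhdsWithin] with z hz using (hquot z hz).symm
  have : (𝓝[nondegenerate] (p, q, r, s)).NeBot :=
    mem_closure_iff_nhdsWithin_neBot.1 (dense_nondegenerate _)
  exact tendsto_nhds_unique (tendsto_quotientFormula ha hb hab p q r s) ht

/-! ### The kernel of the logarithmic mean -/

theorem log_logMean_rpow {a b : ℝ} (ha : 0 < a) (hb : 0 < b) (hab : a ≠ b) {x : ℝ} (hx : x ≠ 0) :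
    Real.log (logMean (a ^ x) (b ^ x)) = (Real.log a + Real.log b) / 2 * x +
      (Real.log (Real.sinh ((Real.log a - Real.log b) / 2 * x)) -
        Real.log ((Real.log a - Real.log b) / 2 * x)) := by
  have hc : Real.log a - Real.log b ≠ 0 := by
    intro h
    exact hab (Real.log_injOn_pos ha hb (by linarith))
  have hne : a ^ x ≠ b ^ x := fun h => hab ((Real.rpow_left_inj ha.le hb.le hx).1 h)
  have h0 : (Real.log a - Real.log b) / 2 * x ≠ 0 := mul_ne_zero (div_ne_zero hc two_ne_zero) hx
  have hs : Real.sinh ((Real.log a - Real.log b) / 2 * x) ≠ 0 := Real.sinh_ne_zero.2 h0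
  -- sinh(hx) and hx may both be negative; `Real.log` ignores the sign, so the difference is still
  -- the logarithm of their positive quotient.
  rw [← Real.log_div hs h0, ← Real.log_exp ((Real.log a + Real.log b) / 2 * x),
    ← Real.log_mul (Real.exp_pos _).ne' (div_ne_zero hs h0), logMean, if_neg hne,
    Real.log_rpow ha, Real.log_rpow hb, Real.rpow_def_of_pos ha, Real.rpow_def_of_pos hb,
    Real.sinh_eq]
  congr 1
  have e1 : Real.exp (Real.log a * x) = Real.exp ((Real.log a + Real.log b) / 2 * x) *
      Real.exp ((Real.log a - Real.log b) / 2 * x) := by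
    rw [← Real.exp_add]; ring_nf
  have e2 : Real.exp (Real.log b * x) = Real.exp ((Real.log a + Real.log b) / 2 * x) *
      Real.exp (-((Real.log a - Real.log b) / 2 * x)) := by
    rw [← Real.exp_add]; ring_nf
  rw [e1, e2, ← mul_sub, mul_comm x, mul_comm x, ← sub_mul]
  field_simp

/-- Here xφ'(x) = mx + hx coth(hx) - 1, and the left side is its derivative. -/
theorem deriv_add_mul_deriv_deriv_eq_kappa {φ : ℝ → ℝ} {m h : ℝ} (hh : h ≠ 0)
    (hφ : ∀ x, x ≠ 0 → φ x = m * x + (Real.log (Real.sinh (h * x)) - Real.log (h * x)))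
    {x : ℝ} (hx : x ≠ 0) :
    deriv φ x + x * deriv (deriv φ) x = m + h * kappa (h * x) := by
  have hl : ∀ y : ℝ, HasDerivAt (fun y : ℝ => h * y) h y := fun y => by
    simpa using (hasDerivAt_id y).const_mul h
  have h1 : ∀ y, y ≠ 0 →
      deriv φ y = m + (h * (Real.cosh (h * y) / Real.sinh (h * y)) - 1 / y) := by
    intro y hy
    have hs : Real.sinh (h * y) ≠ 0 := Real.sinh_ne_zero.2 (mul_ne_zero hh hy)
    have he : φ =ᶠ[𝓝 y] fun x => m * x + (Real.log (Real.sinh (h * x)) - Real.log (h * x)) := by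
      filter_upwards [isOpen_ne.mem_nhds hy] with z hz using hφ z hz
    have hd := ((hasDerivAt_id y).const_mul m).add
      ((((hl y).sinh).log hs).sub ((hl y).log (mul_ne_zero hh hy)))
    rw [he.deriv_eq]
    refine hd.deriv.trans ?_
    field_simp
  have hs : Real.sinh (h * x) ≠ 0 := Real.sinh_ne_zero.2 (mul_ne_zero hh hx)
  have he : deriv φ =ᶠ[𝓝 x]
      fun y => m + (h * (Real.cosh (h * y) / Real.sinh (h * y)) - 1 / y) := by
    filter_upwards [isOpen_ne.mem_nhds hx] with z hz using h1 z hz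
  have hd := (((((hl x).cosh).div ((hl x).sinh) hs).const_mul h).sub
    ((hasDerivAt_const x (1 : ℝ)).div (hasDerivAt_id x) hx)).const_add m
  have h2 : deriv (deriv φ) x = _ := he.deriv_eq.trans hd.deriv
  rw [h2, h1 x hx, kappa]
  have h3 := Real.cosh_sq (h * x)
  simp
  field_simp
  rw [h3]
  ring

/-- The mean as the exponential of an iterated segment mean of a continuous function which is
strictly concave on `[0, ∞)` and antisymmetric about `(0, c / 2)`. -/
theorem exists_kernel {a b : ℝ} (ha : 0 < a) (hb : 0 < b) (hab : a ≠ b) :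
    ∃ (θ : ℝ → ℝ) (c : ℝ), Continuous θ ∧ (∀ x, θ (-x) = c - θ x) ∧
      StrictConcaveOn ℝ (Ici 0) θ ∧ ∀ p q r s, moreExtendedMean p q r s a b =
        Real.exp (segmentMean (fun t => segmentMean (fun w => θ (t * w)) r s) p q) := by
  set φ : ℝ → ℝ := fun x => Real.log (logMean (a ^ x) (b ^ x)) with hφ
  set m := (Real.log a + Real.log b) / 2 with hm
  set h := (Real.log a - Real.log b) / 2 with hdef
  have hh : h ≠ 0 := by
    intro h0
    exact hab (Real.log_injOn_pos ha hb (by linarith))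
  have hC : ContDiff ℝ 2 φ := contDiff_log_logMean ha hb hab
  have h1 : ContDiff ℝ 1 (deriv φ) := by
    have : ContDiff ℝ (1 + 1) φ := by simpa [one_add_one_eq_two] using hC
    exact (contDiff_succ_iff_deriv.1 this).2.2
  have c1 : Continuous (deriv φ) := h1.continuous
  have c2 : Continuous (deriv (deriv φ)) := h1.continuous_deriv le_rfl
  have he : ∀ x, x ≠ 0 → deriv φ x + x * deriv (deriv φ) x = m + h * kappa (h * x) := fun x hx =>
    deriv_add_mul_deriv_deriv_eq_kappa hh (fun y hy => log_logMean_rpow ha hb hab hy) hx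
  have hcont : Continuous fun x => deriv φ x + x * deriv (deriv φ) x := by fun_prop
  refine ⟨fun x => deriv φ x + x * deriv (deriv φ) x, 2 * m, hcont, ?_,
    strictConcaveOn_of_eq_kappa hcont hh he, fun p q r s =>
      moreExtendedMean_eq_exp_segmentMean ha hb hab hφ p q r s⟩
  -- The formula with κ is known only off 0; both sides are continuous, so the symmetry extends to
  -- 0.
  refine congrFun (Continuous.ext_on (dense_compl_singleton (0 : ℝ)) (by fun_prop)
    (by fun_prop) fun x hx => ?_)
  simp only
  rw [he x hx, he (-x) (neg_ne_zero.2 hx), mul_neg, kappa_neg]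
  ring

end MoreExtendedMean

theorem theorem3p1 (r s a b : ℝ) (ha : 0 < a) (hb : 0 < b) (hab : a ≠ b) :
    (0 < r + s →
      MoreExtendedMean.StrictLogConcaveOn (Set.Ici 0 ×ˢ Set.Ici 0)
          (fun x => MoreExtendedMean.moreExtendedMean x.1 x.2 r s a b) ∧
        MoreExtendedMean.StrictLogConvexOn (Set.Iic 0 ×ˢ Set.Iic 0)
          (fun x => MoreExtendedMean.moreExtendedMean x.1 x.2 r s a b)) ∧
    (r + s < 0 →
      MoreExtendedMean.StrictLogConvexOn (Set.Ici 0 ×ˢ Set.Ici 0)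
          (fun x => MoreExtendedMean.moreExtendedMean x.1 x.2 r s a b) ∧
        MoreExtendedMean.StrictLogConcaveOn (Set.Iic 0 ×ˢ Set.Iic 0)
          (fun x => MoreExtendedMean.moreExtendedMean x.1 x.2 r s a b)) := by
  open MoreExtendedMean in
  obtain ⟨θ, c, hθ, hodd, hconc, hF⟩ := exists_kernel ha hb hab
  have hcont := continuous_segmentMean_dilation hθ r s
  have hneg := segmentMean_dilation_neg hθ hodd
  simp only [StrictLogConcaveOn, StrictLogConvexOn, hF, Real.log_exp]
  refine ⟨fun hrs => ?_, fun hrs => ?_⟩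
  · have hc := strictConcaveOn_segmentMean_dilation hθ hodd hconc hrs
    refine ⟨⟨fun _ _ => Real.exp_pos _, strictConcaveOn_segmentMean hcont hc⟩,
      fun _ _ => Real.exp_pos _, strictConvexOn_segmentMean hcont ?_⟩
    -- For t ≤ 0 the inner mean at t is c minus its value at -t ≥ 0.
    convert hc.comp_neg_Iic.const_sub c using 2 with t
    rw [hneg, sub_sub_cancel]
  -- Negating (r, s) makes the sum positive and amounts to replacing t by -t in the inner mean.
  · have hc := strictConcaveOn_segmentMean_dilation hθ hodd hconc (r := -r) (s := -s)
      (by linarith)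
    simp only [segmentMean_dilation_neg_neg] at hc
    refine ⟨⟨fun _ _ => Real.exp_pos _, strictConvexOn_segmentMean hcont ?_⟩,
      fun _ _ => Real.exp_pos _, strictConcaveOn_segmentMean hcont ?_⟩
    · convert hc.const_sub c using 2 with t
      rw [hneg, sub_sub_cancel]
    · simpa using hc.comp_neg_Iic
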